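/- \textbf{Setting.} TLA$^+$ values are sets; a function with domain $D$ and values in $V$ is an element of $[D\to V]$, and $f[d]$ is the value of $f$ at $d$. A state assigns a value to every variable and a behavior is an infinite sequence of states. State expressions are evaluated in a state; actions and other transition expressions are evaluated in a pair (old state, new state), and a prime marks the value in the new state. $\Box[N]_{f}$ holds of a behavior iff every step satisfies $N$ or $f'=f$. For a variable $p$, $\exists\!\!\exists p:F$ holds of a behavior $\sigma$ iff there are behaviors $\rho,\tau$ such that $\sigma$ and $\rho$ are equal after removal of all stuttering steps (repetitions of a state, an infinite constant tail being kept), $\rho$ and $\tau$ are identical except for the values assigned to $p$, and $F$ holds of $\tau$; in the simplified reading, $\rho=\sigma$ is required. A disjunctive representation of an action writes it in terms of subactions using only $\lor$ and $\exists k\in K$; the context $\langle\mathbf k;\mathbf K\rangle$ of a subaction $A$ lists the bound identifiers, with their bounds, in whose scope $A$ lies. \textbf{Data.} Let $vars$ be a tuple of variables, $p$ a variable not in $vars$, $Spec = Init\land\Box[Next]_{vars}$, and fix a disjunctive representation of $Next$. Let $\Pi$ be a nonempty constant set, $Dom$ a set-valued state function, and for each subaction $A$ let $Pred_A(\cdot)$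 be a predicate, and $DomInj_A$, $PredDom_A$ be transition expressions, which may contain the identifiers of the context of $A$. No variables other than those of $vars$ occur in $Init$, $Dom$, the bounds $\mathbf K$, $A$, $Pred_A$, $DomInj_A$, $PredDom_A$. Let $$NewPSet_A(p)=\{q\in[Dom'\to\Pi] : \forall d\in(\mathrm{DOMAIN}\ DomInj_A)\setminus PredDom_A:\ q[DomInj_A[d]]=p[d]\},$$ $$A^p = A\land Pred_A(p)\land p'\in NewPSet_A(p),$$ let $Next^p$ be $Next$ with each subaction $A$ replaced by $A^p$, and let $Spec^p = Init\land (p\in[Dom\to\Pi])\land\Box[Next^p]_{\langle vars,p\rangle}$. \textbf{Theorem.} (1) Suppose that for every subaction $A$, with context $\langle\mathbf k;\mathbf K\rangle$, $$Spec\Rightarrow\Box[\forall\langle\mathbf k;\mathbf K\rangle: ProphCondition_A]_{vars},$$ where $ProphCondition_A$ says that $A$ implies the conjunction of: (i) there is $q\in[Dom\to\Pi]$ with $Pred_A(q)$; (ii) $DomInj_A$ is an injective function from a subset of $Dom$ to $Dom'$; (iii) $PredDom_A\subseteq Dom$, and $Pred_A(q)\equiv Pred_A(r)$ for all $q,r\in[Dom\to\Pi]$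 that agree on $PredDom_A$. Then $\exists\!\!\exists p:Spec^p$ is equivalent to $Spec$ (in either reading of $\exists\!\!\exists$). (2) (Prophecy arrays.) If each $DomInj_A$ is the identity function on $Dom\cap Dom'$, the same conclusion holds when $ProphCondition_A$ is replaced by: $A$ implies (i) and (iii). (3) (One-prediction variables.) Suppose instead that each $A$ is replaced by $A\land Pred_A(p)\land Setp_A$, where $Setp_A$ is either $p'\in\Pi$, or $p'=p$, the latter allowed only if $Pred_A$ is $\mathrm{TRUE}$, that the initial condition is $Init\land(p\in\Pi)$, and that $Spec\Rightarrow\Box[\forall\langle\mathbf k;\mathbf K\rangle:A\Rightarrow\exists i\in\Pi:Pred_A(i)]_{vars}$ for every subaction $A$. Then $\exists\!\!\exists p$ of the resulting specification is equivalent to $Spec$ (in either reading of $\exists\!\!\exists$). -/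

import Mathlib

universe u v w

namespace TLA

/-! ### Values, states, behaviors -/

/-- Every TLA+ value is a set; functions are sets of ordered pairs. -/
abbrev Value : Type (u + 1) := ZFSet.{u}

/-- A state assigns a value to every variable. -/
abbrev State (Var : Type v) : Type (max v (u + 1)) := Var → Value.{u}

/-- A behavior is an infinite sequence of states. -/
abbrev Behavior (Var : Type v) : Type (max v (u + 1)) := ℕ → State.{u, v} Var

abbrev StatePred (Var : Type v) : Type (max v (u + 1)) := State.{u, v} Var → Prop

/-- An action relates an old state (unprimed) and a new state (primed). -/
abbrev Action (Var : Type v) : Type (max v (u + 1)) :=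
  State.{u, v} Var → State.{u, v} Var → Prop

abbrev Temporal (Var : Type v) : Type (max v (u + 1)) := Behavior.{u, v} Var → Prop

/-- The value of a tuple of variables in a state. -/
def tup {Var : Type v} (vars : List Var) (s : State.{u, v} Var) : List Value.{u} :=
  vars.map s

/-- The state function `⟨vars, p⟩`. -/
def tupP {Var : Type v} (vars : List Var) (p : Var) (s : State.{u, v} Var) :
    List Value.{u} × Value.{u} :=
  (tup vars s, s p)

/-- `□[N]_f`: every step is an `N` step or leaves the state function `f` unchanged. -/
def BoxAction {Var : Type v} {β : Type w} (N : Action.{u, v} Var)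
    (f : State.{u, v} Var → β) : Temporal.{u, v} Var :=
  fun σ => ∀ n, N (σ n) (σ (n + 1)) ∨ f (σ (n + 1)) = f (σ n)

/-- The specification `Init ∧ □[Next]_f`. -/
def Spec {Var : Type v} {β : Type w} (Init : StatePred.{u, v} Var) (Next : Action.{u, v} Var)
    (f : State.{u, v} Var → β) : Temporal.{u, v} Var :=
  fun σ => Init (σ 0) ∧ BoxAction Next f σ

/-- The only variables on which the state-level expression `e` depends are those in `vars`. -/
def StateDep {Var : Type v} {β : Type w} (vars : List Var) (e : State.{u, v} Var → β) : Prop :=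
  ∀ s t, tup vars s = tup vars t → e s = e t

/-- The only variables that matter (primed or unprimed) to the transition-level expression `e`
are those in `vars`. -/
def StepDep {Var : Type v} {β : Type w} (vars : List Var)
    (e : State.{u, v} Var → State.{u, v} Var → β) : Prop :=
  ∀ s s' t t', tup vars s = tup vars t → tup vars s' = tup vars t' → e s s' = e t t'

/-! ### The hiding operator -/

open Classical in
/-- The first position after `n` at which the state differs from the one at `n`; if there is
none, then `n + 1`. -/
noncomputable def nextChange {Var : Type v} (σ : Behavior.{u, v} Var) (n : ℕ) : ℕ :=
  if h : ∃ m, n < m ∧ σ m ≠ σ n then Nat.find h else n + 1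

/-- `♮σ`: the behavior obtained from `σ` by removing all stuttering steps, except that an
infinite constant tail is kept. -/
noncomputable def destutter {Var : Type v} (σ : Behavior.{u, v} Var) : Behavior.{u, v} Var :=
  fun k => σ ((nextChange σ)^[k] 0)

/-- The behaviors are identical except for the values that their states assign to `x`. -/
def SameExcept {Var : Type v} (x : Var) (σ τ : Behavior.{u, v} Var) : Prop :=
  ∀ n y, y ≠ x → σ n y = τ n y

/-- The temporal existential quantifier: up to stuttering, values for `x` can be
found that make `F` true. -/
def EE {Var : Type v} (x : Var) (F : Temporal.{u, v} Var) : Temporal.{u, v} Var :=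
  fun σ => ∃ ρ τ, destutter σ = destutter ρ ∧ SameExcept x ρ τ ∧ F τ

/-- The simplified temporal existential quantifier, which may not add or remove stuttering
steps. -/
def EESimple {Var : Type v} (x : Var) (F : Temporal.{u, v} Var) : Temporal.{u, v} Var :=
  fun σ => ∃ τ, SameExcept x σ τ ∧ F τ

/-- `Hides x F G`: the formula `∃∃ x : F` is equivalent to `G`, in both readings of `∃∃`. -/
def Hides {Var : Type v} (x : Var) (F G : Temporal.{u, v} Var) : Prop :=
  (∀ σ, EE x F σ ↔ G σ) ∧ (∀ σ, EESimple x F σ ↔ G σ)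

/-! ### Disjunctive representations -/

/-- A disjunctive representation: subactions (described by elements of `α`) combined by
disjunction and by `∃ k ∈ K`.  The bound `K` may depend on the old and the new state, and both
`K` and the subactions may depend on the identifiers bound further out.  Since `K` is a class
of values, unbounded quantification is covered too. -/
inductive DisjRep (Var : Type v) (α : Type w) : Type (max v w (u + 1))
  | sub (a : α) : DisjRep Var α
  | or (l r : DisjRep Var α) : DisjRep Var α
  | ex (K : State.{u, v} Var → State.{u, v} Var → Set Value.{u})
      (body : Value.{u} → DisjRep Var α) : DisjRep Var α

namespace DisjRep

/-- The action represented, if the subaction described by `a` is `act a`. -/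
def action {Var : Type v} {α : Type w} (act : α → Action.{u, v} Var) :
    DisjRep.{u} Var α → Action.{u, v} Var
  | sub a => act a
  | or l r => fun s s' => action act l s s' ∨ action act r s s'
  | ex K body => fun s s' => ∃ k ∈ K s s', action act (body k) s s'

/-- The conjunction, over all subactions, of `∀ ⟨k; K⟩ : C a`, where `⟨k; K⟩` is the context of
the subaction described by `a`. -/
def allContexts {Var : Type v} {α : Type w} (C : α → Action.{u, v} Var) :
    DisjRep.{u} Var α → Action.{u, v} Var
  | sub a => C a
  | or l r => fun s s' => allContexts C l s s' ∧ allContexts C r s s'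
  | ex K body => fun s s' => ∀ k ∈ K s s', allContexts C (body k) s s'

/-- The representation mentions only variables in `vars`: all bounds do, and all
subactions do, as expressed by `D`. -/
def Dep {Var : Type v} {α : Type w} (vars : List Var) (D : α → Prop) :
    DisjRep.{u} Var α → Prop
  | sub a => D a
  | or l r => Dep vars D l ∧ Dep vars D r
  | ex K body => StepDep vars K ∧ ∀ k, Dep vars D (body k)

/-- Change the descriptions of the subactions. -/
def map {Var : Type v} {α β : Type w} (g : α → β) : DisjRep.{u} Var α → DisjRep.{u} Var β
  | sub a => sub (g a)
  | or l r => or (map g l) (map g r)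
  | ex K body => ex K (fun k => map g (body k))

end DisjRep

/-! ### Functions as values -/

/-- `DOMAIN f`. -/
noncomputable def fdom (f : Value.{u}) : Value.{u} :=
  ZFSet.sep (fun x => ∃ y, ZFSet.pair x y ∈ f) (ZFSet.sUnion (ZFSet.sUnion f))

open Classical in
/-- `f[x]`, for `x` in the domain of the function `f` (and `∅` for other `x`). -/
noncomputable def app (f x : Value.{u}) : Value.{u} :=
  if h : ∃ y, ZFSet.pair x y ∈ f then h.choose else ∅

/-- The identity function with domain `S`. -/
noncomputable def idFcn (S : Value.{u}) : Value.{u} :=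
  ZFSet.sep (fun z => ∃ d, z = ZFSet.pair d d) (ZFSet.prod S S)

/-- The partial injections from `U` to `V`. -/
def PartialInjections (U V : Value.{u}) : Set Value.{u} :=
  {f | (∃ D, D ⊆ U ∧ f ∈ ZFSet.funs D V) ∧
    ∀ a ∈ fdom f, ∀ b ∈ fdom f, a ≠ b → app f a ≠ app f b}

/-! ### The operators of the prophecy module

The parameters are the set `P` of possible predictions, the domain `Dom` of the prophecy in the
old state, and its domain `Dom'` in the new state. -/

/-- The functions `q` from `Dom'` to `P` such that `q[DomInj[d]] = p[d]` for every `d` in the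
domain of `DomInj` that is not in `PredDom`. -/
def NewPSet (P Dom' p DomInj PredDom : Value.{u}) : Set Value.{u} :=
  {q | q ∈ ZFSet.funs Dom' P ∧
    ∀ d ∈ fdom DomInj, d ∉ PredDom → app q (app DomInj d) = app p d}

def ProphAction (P Dom' : Value.{u}) (A : Prop) (p p' DomInj PredDom : Value.{u})
    (Pred : Value.{u} → Prop) : Prop :=
  A ∧ Pred p ∧ p' ∈ NewPSet P Dom' p DomInj PredDom

def ExistsGoodProphecy (P Dom : Value.{u}) (Pred : Value.{u} → Prop) : Prop :=
  ∃ q ∈ ZFSet.funs Dom P, Pred q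

def IsDomInj (Dom Dom' DomInj : Value.{u}) : Prop :=
  DomInj ∈ PartialInjections Dom Dom'

def IsPredDom (P Dom PredDom : Value.{u}) (Pred : Value.{u} → Prop) : Prop :=
  PredDom ⊆ Dom ∧
    ∀ q ∈ ZFSet.funs Dom P, ∀ r ∈ ZFSet.funs Dom P,
      (∀ d ∈ PredDom, app q d = app r d) → (Pred q ↔ Pred r)

def ProphCondition (P Dom Dom' : Value.{u}) (A : Prop) (DomInj PredDom : Value.{u})
    (Pred : Value.{u} → Prop) : Prop :=
  A → ExistsGoodProphecy P Dom Pred ∧ IsDomInj Dom Dom' DomInj ∧ IsPredDom P Dom PredDom Pred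

/-! ### Adding a prophecy data structure variable -/

/-- A subaction `A` with the expressions `Pred_A`, `DomInj_A`, `PredDom_A` chosen for it. -/
structure ProphSub (Var : Type v) : Type (max v (u + 1)) where
  act : Action.{u, v} Var
  pred : State.{u, v} Var → State.{u, v} Var → Value.{u} → Prop
  domInj : State.{u, v} Var → State.{u, v} Var → Value.{u}
  predDom : State.{u, v} Var → State.{u, v} Var → Value.{u}

namespace ProphSub

/-- `A`, `Pred_A`, `DomInj_A` and `PredDom_A` contain only variables in `vars`. -/
def Dep {Var : Type v} (vars : List Var) (a : ProphSub.{u, v} Var) : Prop :=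
  StepDep vars a.act ∧ StepDep vars a.pred ∧ StepDep vars a.domInj ∧ StepDep vars a.predDom

/-- The action `A^p`. -/
def actP {Var : Type v} (P : Value.{u}) (Dom : State.{u, v} Var → Value.{u}) (p : Var)
    (a : ProphSub.{u, v} Var) : Action.{u, v} Var :=
  fun s s' => ProphAction P (Dom s') (a.act s s') (s p) (s' p) (a.domInj s s') (a.predDom s s')
    (a.pred s s')

/-- The condition on the choices made for `A`. -/
def cond {Var : Type v} (P : Value.{u}) (Dom : State.{u, v} Var → Value.{u})
    (a : ProphSub.{u, v} Var) : Action.{u, v} Var :=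
  fun s s' => ProphCondition P (Dom s) (Dom s') (a.act s s') (a.domInj s s') (a.predDom s s')
    (a.pred s s')

end ProphSub

/-- `Init^p`. -/
def InitP {Var : Type v} (Init : StatePred.{u, v} Var) (P : Value.{u})
    (Dom : State.{u, v} Var → Value.{u}) (p : Var) : StatePred.{u, v} Var :=
  fun s => Init s ∧ s p ∈ ZFSet.funs (Dom s) P

/-- `Spec^p = Init^p ∧ □[Next^p]_⟨vars, p⟩`, where `Next^p` is obtained from `Next` by replacing
each subaction `A` of its disjunctive representation with `A^p`. -/
def SpecP {Var : Type v} (vars : List Var) (p : Var) (Init : StatePred.{u, v} Var) (P : Value.{u})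
    (Dom : State.{u, v} Var → Value.{u}) (rep : DisjRep.{u} Var (ProphSub.{u, v} Var)) :
    Temporal.{u, v} Var :=
  Spec (InitP Init P Dom p) (rep.action (ProphSub.actP P Dom p)) (tupP vars p)

/-! ### Prophecy array variables -/

/-- A subaction `A` with the expressions `Pred_A` and `PredDom_A` chosen for it. -/
structure ArraySub (Var : Type v) : Type (max v (u + 1)) where
  act : Action.{u, v} Var
  pred : State.{u, v} Var → State.{u, v} Var → Value.{u} → Prop
  predDom : State.{u, v} Var → State.{u, v} Var → Value.{u}

namespace ArraySub

def Dep {Var : Type v} (vars : List Var) (a : ArraySub.{u, v} Var) : Prop :=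
  StepDep vars a.act ∧ StepDep vars a.pred ∧ StepDep vars a.predDom

/-- For an array, `DomInj_A` is the identity function on `Dom ∩ Dom'`. -/
noncomputable def toProphSub {Var : Type v} (Dom : State.{u, v} Var → Value.{u})
    (a : ArraySub.{u, v} Var) : ProphSub.{u, v} Var where
  act := a.act
  pred := a.pred
  domInj := fun s s' => idFcn (Dom s ∩ Dom s')
  predDom := a.predDom

def cond {Var : Type v} (P : Value.{u}) (Dom : State.{u, v} Var → Value.{u})
    (a : ArraySub.{u, v} Var) : Action.{u, v} Var :=
  fun s s' => a.act s s' →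
    ExistsGoodProphecy P (Dom s) (a.pred s s') ∧
      IsPredDom P (Dom s) (a.predDom s s') (a.pred s s')

end ArraySub

/-! ### One-prediction prophecy variables -/

/-- A subaction `A` with the choices made for a one-prediction variable: either `Pred_A` is
`TRUE` and `A^p` leaves `p` unchanged, or `Pred_A` is arbitrary and `A^p` sets `p` to any
element of the set of possible predictions. -/
inductive OneSub (Var : Type v) : Type (max v (u + 1))
  | keep (act : Action.{u, v} Var) : OneSub Var
  | renew (act : Action.{u, v} Var)
      (pred : State.{u, v} Var → State.{u, v} Var → Value.{u} → Prop) : OneSub Var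

namespace OneSub

def act {Var : Type v} : OneSub.{u, v} Var → Action.{u, v} Var
  | keep A => A
  | renew A _ => A

def pred {Var : Type v} :
    OneSub.{u, v} Var → State.{u, v} Var → State.{u, v} Var → Value.{u} → Prop
  | keep _ => fun _ _ _ => True
  | renew _ Pred => Pred

/-- The formula that determines the value of `p'`. -/
def setp {Var : Type v} (P : Value.{u}) (p : Var) : OneSub.{u, v} Var → Action.{u, v} Var
  | keep _ => fun s s' => s' p = s p
  | renew _ _ => fun _ s' => s' p ∈ P

def Dep {Var : Type v} (vars : List Var) (a : OneSub.{u, v} Var) : Prop :=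
  StepDep vars a.act ∧ StepDep vars a.pred

def actP {Var : Type v} (P : Value.{u}) (p : Var) (a : OneSub.{u, v} Var) : Action.{u, v} Var :=
  fun s s' => a.act s s' ∧ a.pred s s' (s p) ∧ a.setp P p s s'

def cond {Var : Type v} (P : Value.{u}) (a : OneSub.{u, v} Var) : Action.{u, v} Var :=
  fun s s' => a.act s s' → ∃ i ∈ P, a.pred s s' i

end OneSub

/-- The specification obtained by adding a one-prediction prophecy variable. -/
def SpecOne {Var : Type v} (vars : List Var) (p : Var) (Init : StatePred.{u, v} Var)
    (P : Value.{u}) (rep : DisjRep.{u} Var (OneSub.{u, v} Var)) : Temporal.{u, v} Var :=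
  Spec (fun s => Init s ∧ s p ∈ P) (rep.action (OneSub.actP P p)) (tupP vars p)

end TLA

namespace TLA

/-! ### Functions as values -/

/-! Hiding `p` gives nothing new: the extended specification only adds conjuncts, and the original
one ignores `p` and is insensitive to stuttering (`boxAction_destutter_iff`).

Conversely, a behavior of the original specification needs only values for `p`, with no steps added,
so one construction serves both readings (`hides_of_exists_values`). At each non-stuttering step fix
one subaction that occurs and a prophecy `q` that is good for it. An entry `d` in its `PredDom` is
forced to be `q[d]`; any other entry is passed on, along `DomInj`, to the next state. Thus every
entry is determined by its future: follow it until it first lies in a `PredDom` and read the value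
there, or use a fixed default if that never happens (`exists_resolution`). The resulting function
agrees with `q` on `PredDom`, so condition (iii) makes it satisfy `Pred`, and the passing-on rule is
membership in `NewPSet` (`exists_prophecy_step`).

Arrays are an instance of this; one-prediction variables use the same resolution with a single
entry. -/

theorem pair_app_mem {D V f d : Value.{u}} (hf : f ∈ ZFSet.funs D V) (hd : d ∈ D) :
    ZFSet.pair d (app f d) ∈ f := by
  have h : ∃ y, ZFSet.pair d y ∈ f := ((ZFSet.mem_funs.1 hf).2 d hd).exists
  rw [app, dif_pos h]
  exact h.choose_spec

theorem app_mem {D V f d : Value.{u}} (hf : f ∈ ZFSet.funs D V) (hd : d ∈ D) : app f d ∈ V :=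
  (ZFSet.pair_mem_prod.1 ((ZFSet.mem_funs.1 hf).1 (pair_app_mem hf hd))).2

theorem app_eq_of_pair_mem {D V f d y : Value.{u}} (hf : f ∈ ZFSet.funs D V)
    (h : ZFSet.pair d y ∈ f) : app f d = y := by
  have hd : d ∈ D := (ZFSet.pair_mem_prod.1 ((ZFSet.mem_funs.1 hf).1 h)).1
  exact ((ZFSet.mem_funs.1 hf).2 d hd).unique (pair_app_mem hf hd) h

theorem mem_of_mem_fdom {D V f d : Value.{u}} (hf : f ∈ ZFSet.funs D V) (hd : d ∈ fdom f) :
    d ∈ D := by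
  obtain ⟨-, y, hy⟩ := ZFSet.mem_sep.1 hd
  exact (ZFSet.pair_mem_prod.1 ((ZFSet.mem_funs.1 hf).1 hy)).1

theorem subset_of_app_eq {D V f g : Value.{u}} (hf : f ∈ ZFSet.funs D V)
    (hg : g ∈ ZFSet.funs D V) (h : ∀ d ∈ D, app f d = app g d) : f ⊆ g := by
  intro z hz
  obtain ⟨a, ha, b, -, rfl⟩ := ZFSet.mem_prod.1 ((ZFSet.mem_funs.1 hf).1 hz)
  rw [← app_eq_of_pair_mem hf hz, h a ha]
  exact pair_app_mem hg ha

theorem funs_ext {D V f g : Value.{u}} (hf : f ∈ ZFSet.funs D V) (hg : g ∈ ZFSet.funs D V)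
    (h : ∀ d ∈ D, app f d = app g d) : f = g :=
  ZFSet.ext fun _ => ⟨fun hz => subset_of_app_eq hf hg h hz,
    fun hz => subset_of_app_eq hg hf (fun d hd => (h d hd).symm) hz⟩

theorem exists_mem_funs_app_eq (D V : Value.{u}) (g : Value.{u} → Value.{u})
    (hg : ∀ d, g d ∈ V) : ∃ f ∈ ZFSet.funs D V, ∀ d ∈ D, app f d = g d := by
  let f : Value.{u} := ZFSet.sep (fun z => ∃ d, z = ZFSet.pair d (g d)) (ZFSet.prod D V)
  have hmem : ∀ d ∈ D, ZFSet.pair d (g d) ∈ f := fun d hd =>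
    ZFSet.mem_sep.2 ⟨ZFSet.pair_mem_prod.2 ⟨hd, hg d⟩, d, rfl⟩
  have hf : f ∈ ZFSet.funs D V := by
    refine ZFSet.mem_funs.2 ⟨fun z hz => (ZFSet.mem_sep.1 hz).1, fun d hd =>
      ⟨g d, hmem d hd, fun y hy => ?_⟩⟩
    obtain ⟨-, e, he⟩ := ZFSet.mem_sep.1 hy
    obtain ⟨rfl, rfl⟩ := ZFSet.pair_injective he
    rfl
  exact ⟨f, hf, fun d hd => app_eq_of_pair_mem hf (hmem d hd)⟩

theorem pair_mem_idFcn {S d : Value.{u}} (hd : d ∈ S) : ZFSet.pair d d ∈ idFcn S :=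
  ZFSet.mem_sep.2 ⟨ZFSet.pair_mem_prod.2 ⟨hd, hd⟩, d, rfl⟩

theorem idFcn_mem_funs {S V : Value.{u}} (h : S ⊆ V) : idFcn S ∈ ZFSet.funs S V := by
  refine ZFSet.mem_funs.2 ⟨fun z hz => ?_, fun d hd =>
    ⟨d, pair_mem_idFcn hd, fun y hy => ?_⟩⟩
  · obtain ⟨a, ha, b, hb, rfl⟩ := ZFSet.mem_prod.1 (ZFSet.mem_sep.1 hz).1
    exact ZFSet.pair_mem_prod.2 ⟨ha, h hb⟩
  · obtain ⟨-, e, he⟩ := ZFSet.mem_sep.1 hy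
    obtain ⟨rfl, rfl⟩ := ZFSet.pair_injective he
    rfl

theorem isDomInj_idFcn_inter (U V : Value.{u}) : IsDomInj U V (idFcn (U ∩ V)) := by
  have hf : idFcn (U ∩ V) ∈ ZFSet.funs (U ∩ V) V :=
    idFcn_mem_funs fun _ h => (ZFSet.mem_inter.1 h).2
  have happ : ∀ a ∈ fdom (idFcn (U ∩ V)), app (idFcn (U ∩ V)) a = a := fun a ha =>
    app_eq_of_pair_mem hf (pair_mem_idFcn (mem_of_mem_fdom hf ha))
  refine ⟨⟨U ∩ V, fun _ h => (ZFSet.mem_inter.1 h).1, hf⟩, fun a ha b hb hab => ?_⟩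
  rwa [happ a ha, happ b hb]

/-! ### Stuttering invariance -/

section Stuttering

variable {Var : Type v} (σ : Behavior.{u, v} Var)

theorem lt_nextChange (n : ℕ) : n < nextChange σ n := by
  classical
  unfold nextChange
  split_ifs with h
  · exact (Nat.find_spec h).1
  · exact n.lt_succ_self

theorem eq_of_lt_nextChange {n m : ℕ} (hnm : n ≤ m) (hm : m < nextChange σ n) : σ m = σ n := by
  classical
  rcases hnm.eq_or_lt with rfl | hlt
  · rfl
  unfold nextChange at hm
  split_ifs at hm with h
  · by_contra hne
    exact Nat.find_min h hm ⟨hlt, hne⟩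
  · omega

theorem nextChange_le_of_ne {n m : ℕ} (hnm : n < m) (hm : σ m ≠ σ n) : nextChange σ n ≤ m := by
  by_contra! h
  exact hm (eq_of_lt_nextChange σ hnm.le h)

/-- The iterates increase strictly from 0, so they cut the time line into consecutive blocks; by
`eq_of_lt_nextChange` the behavior is constant on each. -/
theorem exists_iterate_nextChange_le_lt (n : ℕ) :
    ∃ k, (nextChange σ)^[k] 0 ≤ n ∧ n < (nextChange σ)^[k + 1] 0 := by
  induction n with
  | zero => exact ⟨0, le_rfl, lt_nextChange σ 0⟩
  | succ n ih =>
    obtain ⟨k, hk, hk'⟩ := ih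
    rcases (Nat.succ_le_of_lt hk').eq_or_lt with h | h
    · refine ⟨k + 1, h.ge, ?_⟩
      rw [Function.iterate_succ_apply', ← h]
      exact lt_nextChange σ _
    · exact ⟨k, hk.trans n.le_succ, h⟩

/-- Steps inside a block are stuttering steps and hold trivially; the step that leaves a block joins
the same two states as a step of the destuttered behavior. -/
theorem boxAction_destutter_iff {β : Type w} (N : Action.{u, v} Var)
    (f : State.{u, v} Var → β) : BoxAction N f (destutter σ) ↔ BoxAction N f σ := by
  constructor
  · intro h n
    by_cases hn : σ (n + 1) = σ n
    · exact Or.inr (congrArg f hn)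
    obtain ⟨k, hk, hk'⟩ := exists_iterate_nextChange_le_lt σ n
    have hstep := h k
    simp only [destutter] at hstep
    rw [Function.iterate_succ_apply'] at hk' hstep
    have hσ : σ n = σ ((nextChange σ)^[k] 0) := eq_of_lt_nextChange σ hk hk'
    -- The state changes right after `n`, so `n` is the last position of its block.
    have hnext : nextChange σ ((nextChange σ)^[k] 0) = n + 1 :=
      le_antisymm (nextChange_le_of_ne σ (Nat.lt_succ_of_le hk) (hσ ▸ hn)) hk'
    rwa [hnext, ← hσ] at hstep
  · intro h k
    simp only [destutter, Function.iterate_succ_apply']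
    generalize (nextChange σ)^[k] 0 = n
    -- `m` is the last position of the block of `n`; in a constant tail it is `n` itself.
    obtain ⟨m, hm⟩ : ∃ m, nextChange σ n = m + 1 :=
      Nat.exists_eq_succ_of_ne_zero (Nat.ne_zero_of_lt (lt_nextChange σ n))
    have hlt := lt_nextChange σ n
    have hσ : σ m = σ n := eq_of_lt_nextChange σ (by omega) (by omega)
    rw [hm, ← hσ]
    exact h m

theorem spec_destutter_iff {β : Type w} (Init : StatePred.{u, v} Var) (N : Action.{u, v} Var)
    (f : State.{u, v} Var → β) : Spec Init N f (destutter σ) ↔ Spec Init N f σ :=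
  and_congr Iff.rfl (boxAction_destutter_iff σ N f)

end Stuttering

/-! ### Hiding an added variable -/

section Hiding

variable {Var : Type v} {vars : List Var} {p : Var}

theorem tup_congr {s t : State.{u, v} Var} (hp : p ∉ vars) (h : ∀ y, y ≠ p → s y = t y) :
    tup vars s = tup vars t :=
  List.map_congr_left fun y hy => h y fun hyp => hp (hyp ▸ hy)

open Classical in
theorem tup_update (hp : p ∉ vars) (s : State.{u, v} Var) (x : Value.{u}) :
    tup vars (Function.update s p x) = tup vars s :=
  tup_congr hp fun _ hy => Function.update_of_ne hy _ _

theorem spec_of_sameExcept {Init : StatePred.{u, v} Var} {Next : Action.{u, v} Var}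
    (hp : p ∉ vars) (hInit : StateDep vars Init) (hNext : StepDep vars Next)
    {σ τ : Behavior.{u, v} Var} (h : SameExcept p σ τ) (hτ : Spec Init Next (tup vars) τ) :
    Spec Init Next (tup vars) σ := by
  have ht : ∀ n, tup vars (σ n) = tup vars (τ n) := fun n => tup_congr hp (h n)
  refine ⟨(hInit _ _ (ht 0)).mpr hτ.1, fun n => ?_⟩
  rw [ht, ht, hNext _ _ _ _ (ht n) (ht (n + 1))]
  exact hτ.2 n

open Classical in
/-- Strengthening the initial predicate and the next-state action by a variable `p` outside
`vars` adds a variable that can be hidden, provided values of `p` can be found along every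
behavior of the original specification. -/
theorem hides_of_exists_values {Init InitP : StatePred.{u, v} Var}
    {Next NextP : Action.{u, v} Var} (hp : p ∉ vars) (hInit : StateDep vars Init)
    (hNext : StepDep vars Next) (hInitP : ∀ s, InitP s → Init s)
    (hNextP : ∀ s s', NextP s s' → Next s s')
    (hex : ∀ σ, Spec Init Next (tup vars) σ → ∃ x : ℕ → Value.{u},
      Spec InitP NextP (tupP vars p) fun n => Function.update (σ n) p (x n)) :
    Hides p (Spec InitP NextP (tupP vars p)) (Spec Init Next (tup vars)) := by
  have hweak : ∀ τ, Spec InitP NextP (tupP vars p) τ → Spec Init Next (tup vars) τ :=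
    fun τ hτ => ⟨hInitP _ hτ.1, fun n => (hτ.2 n).imp (hNextP _ _) (congrArg Prod.fst)⟩
  have hsimple : ∀ σ, Spec Init Next (tup vars) σ →
      ∃ τ, SameExcept p σ τ ∧ Spec InitP NextP (tupP vars p) τ := by
    intro σ hσ
    obtain ⟨x, hx⟩ := hex σ hσ
    exact ⟨_, fun n y hy => (Function.update_of_ne hy _ _).symm, hx⟩
  refine ⟨fun σ => ⟨?_, fun hσ => ?_⟩, fun σ => ⟨?_, hsimple σ⟩⟩
  · rintro ⟨ρ, τ, hστ, hρτ, hτ⟩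
    rw [← spec_destutter_iff, hστ, spec_destutter_iff]
    exact spec_of_sameExcept hp hInit hNext hρτ (hweak τ hτ)
  · obtain ⟨τ, h⟩ := hsimple σ hσ
    exact ⟨σ, τ, rfl, h⟩
  · rintro ⟨τ, hστ, hτ⟩
    exact spec_of_sameExcept hp hInit hNext hστ (hweak τ hτ)

end Hiding

/-! ### Disjunctive representations -/

namespace DisjRep

variable {Var : Type v} {α β : Type w} {vars : List Var}

theorem action_mono {act act' : α → Action.{u, v} Var}
    (h : ∀ a s s', act a s s' → act' a s s') (rep : DisjRep.{u} Var α)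
    {s s' : State.{u, v} Var} (hs : rep.action act s s') : rep.action act' s s' := by
  induction rep with
  | sub a => exact h a s s' hs
  | or l r ihl ihr => exact hs.imp ihl ihr
  | ex K body ih =>
    obtain ⟨k, hk, hs⟩ := hs
    exact ⟨k, hk, ih k hs⟩

theorem allContexts_mono {C C' : α → Action.{u, v} Var} (h : ∀ a s s', C a s s' → C' a s s')
    (rep : DisjRep.{u} Var α) {s s' : State.{u, v} Var} (hs : rep.allContexts C s s') :
    rep.allContexts C' s s' := by
  induction rep with
  | sub a => exact h a s s' hs
  | or l r ihl ihr => exact ⟨ihl hs.1, ihr hs.2⟩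
  | ex K body ih => exact fun k hk => ih k (hs k hk)

theorem Dep.mono {D D' : α → Prop} (h : ∀ a, D a → D' a) {rep : DisjRep.{u} Var α}
    (hrep : rep.Dep vars D) : rep.Dep vars D' := by
  induction rep with
  | sub a => exact h a hrep
  | or l r ihl ihr => exact ⟨ihl hrep.1, ihr hrep.2⟩
  | ex K body ih => exact ⟨hrep.1, fun k => ih k (hrep.2 k)⟩

theorem action_map (g : α → β) (act : β → Action.{u, v} Var) (rep : DisjRep.{u} Var α) :
    (rep.map g).action act = rep.action fun a => act (g a) := by
  induction rep with
  | sub a => rfl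
  | or l r ihl ihr => simp only [map, action, ihl, ihr]
  | ex K body ih => simp only [map, action, ih]

theorem allContexts_map (g : α → β) (C : β → Action.{u, v} Var) (rep : DisjRep.{u} Var α) :
    (rep.map g).allContexts C = rep.allContexts fun a => C (g a) := by
  induction rep with
  | sub a => rfl
  | or l r ihl ihr => simp only [map, allContexts, ihl, ihr]
  | ex K body ih => simp only [map, allContexts, ih]

theorem Dep.map {g : α → β} {D : β → Prop} {rep : DisjRep.{u} Var α}
    (hrep : rep.Dep vars fun a => D (g a)) : (rep.map g).Dep vars D := by
  induction rep with
  | sub a => exact hrep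
  | or l r ihl ihr => exact ⟨ihl hrep.1, ihr hrep.2⟩
  | ex K body ih => exact ⟨hrep.1, fun k => ih k (hrep.2 k)⟩

theorem Dep.stepDep_action {act : α → Action.{u, v} Var} {rep : DisjRep.{u} Var α}
    (hrep : rep.Dep vars fun a => StepDep vars (act a)) : StepDep vars (rep.action act) := by
  intro s s' t t' h h'
  induction rep with
  | sub a => exact hrep s s' t t' h h'
  | or l r ihl ihr => simp only [action, ihl hrep.1, ihr hrep.2]
  | ex K body ih => simp only [action, hrep.1 s s' t t' h h', fun k => ih k (hrep.2 k)]

/-- A step of a represented action is a step of one of its subactions `a`; every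
reinterpretation of the subactions that `a` satisfies, on states with the same values of `vars`,
is then a step of the reinterpreted action. -/
theorem exists_sub_of_action {act C : α → Action.{u, v} Var} {D : α → Prop}
    {rep : DisjRep.{u} Var α} {s s' : State.{u, v} Var} (hrep : rep.Dep vars D)
    (hact : rep.action act s s') (hC : rep.allContexts C s s') :
    ∃ a, act a s s' ∧ C a s s' ∧ D a ∧
      ∀ (act' : α → Action.{u, v} Var) (t t' : State.{u, v} Var), tup vars s = tup vars t →
        tup vars s' = tup vars t' → act' a t t' → rep.action act' t t' := by
  induction rep with
  | sub a => exact ⟨a, hact, hC, hrep, fun _ _ _ _ _ h => h⟩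
  | or l r ihl ihr =>
    rcases hact with hact | hact
    · obtain ⟨a, h₁, h₂, h₃, h⟩ := ihl hrep.1 hact hC.1
      exact ⟨a, h₁, h₂, h₃, fun act' t t' ht ht' ha => Or.inl (h act' t t' ht ht' ha)⟩
    · obtain ⟨a, h₁, h₂, h₃, h⟩ := ihr hrep.2 hact hC.2
      exact ⟨a, h₁, h₂, h₃, fun act' t t' ht ht' ha => Or.inr (h act' t t' ht ht' ha)⟩
  | ex K body ih =>
    obtain ⟨k, hk, hact⟩ := hact
    obtain ⟨a, h₁, h₂, h₃, h⟩ := ih k (hrep.2 k) hact (hC k hk)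
    exact ⟨a, h₁, h₂, h₃, fun act' t t' ht ht' ha =>
      -- The bound mentions only `vars`, so the same witness `k` serves in `t`, `t'`.
      ⟨k, hrep.1 s s' t t' ht ht' ▸ hk, h act' t t' ht ht' ha⟩⟩

end DisjRep

/-! ### Values determined by the future -/

section Resolution

variable {ι : Type v} {V : Type w} (dec : ℕ → ι → Prop) (next : ℕ → ι → ι) (val : ℕ → ι → V)

/-- Following `next` from index `d` at time `n`, the first index at which `dec` holds has the
value `v`. -/
inductive Resolves : ℕ → ι → V → Prop
  | now {n : ℕ} {d : ι} : dec n d → Resolves n d (val n d)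
  | later {n : ℕ} {d : ι} {v : V} : ¬ dec n d → Resolves (n + 1) (next n d) v → Resolves n d v

variable {dec next val}

theorem Resolves.eq_of_dec {n : ℕ} {d : ι} {v : V} (h : Resolves dec next val n d v)
    (hd : dec n d) : v = val n d := by
  cases h with
  | now _ => rfl
  | later hnd _ => exact absurd hd hnd

theorem resolves_iff_of_not_dec {n : ℕ} {d : ι} (hd : ¬ dec n d) (v : V) :
    Resolves dec next val n d v ↔ Resolves dec next val (n + 1) (next n d) v := by
  refine ⟨fun h => ?_, .later hd⟩
  cases h with
  | now h => exact absurd h hd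
  | later _ h => exact h

theorem Resolves.mem {n : ℕ} {d : ι} {v : V} {S : Set V} (hS : ∀ n d, dec n d → val n d ∈ S)
    (h : Resolves dec next val n d v) : v ∈ S := by
  induction h with
  | now h => exact hS _ _ h
  | later _ _ ih => exact ih

/-- An entry whose chain is never decided gets the default `c`. Choosing a value from the predicate
`Resolves n d` itself, rather than from the pair `(n, d)`, makes all undecided links of a chain
agree. -/
theorem exists_resolution (dec : ℕ → ι → Prop) (next : ℕ → ι → ι) (val : ℕ → ι → V) {S : Set V}
    (hne : S.Nonempty) (hS : ∀ n d, dec n d → val n d ∈ S) :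
    ∃ g : ℕ → ι → V, (∀ n d, g n d ∈ S) ∧ (∀ n d, dec n d → g n d = val n d) ∧
      ∀ n d, ¬ dec n d → g (n + 1) (next n d) = g n d := by
  classical
  obtain ⟨c, hc⟩ := hne
  let pick : (V → Prop) → V := fun Q => if h : ∃ v, Q v then h.choose else c
  refine ⟨fun n d => pick (Resolves dec next val n d), fun n d => ?_, fun n d hd => ?_,
    fun n d hd => ?_⟩
  · by_cases h : ∃ v, Resolves dec next val n d v
    · simpa only [pick, dif_pos h] using h.choose_spec.mem hS
    · simpa only [pick, dif_neg h] using hc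
  · have h : ∃ v, Resolves dec next val n d v := ⟨_, .now hd⟩
    simpa only [pick, dif_pos h] using h.choose_spec.eq_of_dec hd
  -- Both ends of the link have the same predicate, hence the same pick, whether or not the chain is
  -- ever decided.
  · exact congrArg pick (funext fun v => propext (resolves_iff_of_not_dec hd v)).symm

end Resolution

/-! ### Adding prophecy variables -/

section Prophecy

variable {Var : Type v} {vars : List Var} {p : Var}

open Classical in
theorem tupP_update_eq (hp : p ∉ vars) {s s' : State.{u, v} Var} (h : tup vars s' = tup vars s)
    (x : Value.{u}) :
    tupP vars p (Function.update s' p x) = tupP vars p (Function.update s p x) := by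
  simp only [tupP, tup_update hp, h, Function.update_self]

open Classical in
-- Reduces one step to local rules on entries, decided by `dec` and `val` or passed on by `next`;
-- these are the data that `exists_resolution` takes.
theorem exists_prophecy_step {P : Value.{u}} {Dom : State.{u, v} Var → Value.{u}}
    {rep : DisjRep.{u} Var (ProphSub.{u, v} Var)} (hp : p ∉ vars) (hDom : StateDep vars Dom)
    (hrep : rep.Dep vars (ProphSub.Dep vars)) {s s' : State.{u, v} Var}
    (hstep : rep.action ProphSub.act s s' ∨ tup vars s' = tup vars s)
    (hcond : rep.allContexts (ProphSub.cond P Dom) s s' ∨ tup vars s' = tup vars s) :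
    ∃ (dec : Value.{u} → Prop) (next val : Value.{u} → Value.{u}),
      (∀ d, dec d → val d ∈ P) ∧
      ∀ x ∈ ZFSet.funs (Dom s) P, ∀ x' ∈ ZFSet.funs (Dom s') P,
        (∀ d ∈ Dom s, dec d → app x d = val d) →
        (∀ d ∈ Dom s, ¬ dec d → next d ∈ Dom s' → app x' (next d) = app x d) →
        rep.action (ProphSub.actP P Dom p) (Function.update s p x) (Function.update s' p x') ∨
          tupP vars p (Function.update s' p x') = tupP vars p (Function.update s p x) := by
  by_cases hst : tup vars s' = tup vars s
  -- A stuttering step decides nothing and carries every entry to itself, so `p` is unchanged.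
  · refine ⟨fun _ => False, id, id, fun _ h => h.elim, fun x hx x' hx' _ hkeep => Or.inr ?_⟩
    rw [hDom _ _ hst] at hx' hkeep
    rw [funs_ext hx' hx fun d hd => hkeep d hd id hd]
    exact tupP_update_eq hp hst x
  obtain ⟨a, hact, hC, hD, hlift⟩ :=
    DisjRep.exists_sub_of_action hrep (hstep.resolve_right hst) (hcond.resolve_right hst)
  obtain ⟨⟨q, hq, hqpred⟩, ⟨⟨D, hDsub, hinj⟩, -⟩, hsub, hagree⟩ := hC hact
  -- Off the domain of `DomInj`, `app` returns `∅`; if `∅` lies in the new domain this adds a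
  -- spurious constraint, harmless because resolution works for any map `next`.
  refine ⟨fun d => d ∈ a.predDom s s', app (a.domInj s s'), app q,
    fun d hd => app_mem hq (hsub hd), fun x hx x' hx' hval hkeep => Or.inl ?_⟩
  have hs := (tup_update hp s x).symm
  have hs' := (tup_update hp s' x').symm
  obtain ⟨hDa, hDp, hDi, hDd⟩ := hD
  refine hlift _ _ _ hs hs' ?_
  simp only [ProphSub.actP, Function.update_self, ← hDa _ _ _ _ hs hs', ← hDp _ _ _ _ hs hs',
    ← hDi _ _ _ _ hs hs', ← hDd _ _ _ _ hs hs', ← hDom _ _ hs']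
  refine ⟨hact, (hagree x hx q hq fun d hd => hval d (hsub hd) hd).2 hqpred, hx',
    fun d hd hnd => ?_⟩
  have hdD := mem_of_mem_fdom hinj hd
  exact hkeep d (hDsub hdD) hnd (app_mem hinj hdD)

/-- Adding a prophecy data structure variable. -/
theorem hides_specP {Init : StatePred.{u, v} Var} {P : Value.{u}}
    {Dom : State.{u, v} Var → Value.{u}} {rep : DisjRep.{u} Var (ProphSub.{u, v} Var)}
    (hp : p ∉ vars) (hInit : StateDep vars Init) (hP : P.Nonempty) (hDom : StateDep vars Dom)
    (hrep : rep.Dep vars (ProphSub.Dep vars))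
    (hcond : ∀ σ, Spec Init (rep.action ProphSub.act) (tup vars) σ →
      BoxAction (rep.allContexts (ProphSub.cond P Dom)) (tup vars) σ) :
    Hides p (SpecP vars p Init P Dom rep) (Spec Init (rep.action ProphSub.act) (tup vars)) := by
  classical
  refine hides_of_exists_values hp hInit (hrep.mono fun a h => h.1).stepDep_action
    (fun s h => h.1) (fun s s' => rep.action_mono fun a s s' h => h.1) fun σ hσ => ?_
  choose dec next val hval hstep using fun n =>
    exists_prophecy_step hp hDom hrep (hσ.2 n) (hcond σ hσ n)
  obtain ⟨g, hgP, hgdec, hgnext⟩ := exists_resolution dec next val (S := {y | y ∈ P}) hP hval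
  -- Resolution runs over all values; `p` at time `n` is its restriction to the current domain.
  choose x hx happ using fun n => exists_mem_funs_app_eq (Dom (σ n)) P (g n) (hgP n)
  refine ⟨x, ⟨?_, ?_⟩, fun n => hstep n (x n) (hx n) (x (n + 1)) (hx (n + 1)) ?_ ?_⟩
  · exact (hInit _ _ (tup_update hp (σ 0) (x 0))).mpr hσ.1
  · simpa only [Function.update_self, hDom _ _ (tup_update hp (σ 0) (x 0))] using hx 0
  · intro d hd hdec
    rw [happ n d hd, hgdec n d hdec]
  · intro d hd hdec hnext
    rw [happ n d hd, happ (n + 1) _ hnext, hgnext n d hdec]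

/-- Adding a prophecy array variable. -/
theorem hides_specP_array {Init : StatePred.{u, v} Var} {P : Value.{u}}
    {Dom : State.{u, v} Var → Value.{u}} {rep : DisjRep.{u} Var (ArraySub.{u, v} Var)}
    (hp : p ∉ vars) (hInit : StateDep vars Init) (hP : P.Nonempty) (hDom : StateDep vars Dom)
    (hrep : rep.Dep vars (ArraySub.Dep vars))
    (hcond : ∀ σ, Spec Init (rep.action ArraySub.act) (tup vars) σ →
      BoxAction (rep.allContexts (ArraySub.cond P Dom)) (tup vars) σ) :
    Hides p (SpecP vars p Init P Dom (rep.map (ArraySub.toProphSub Dom)))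
      (Spec Init (rep.action ArraySub.act) (tup vars)) := by
  have hact : (rep.map (ArraySub.toProphSub Dom)).action ProphSub.act =
      rep.action ArraySub.act := rep.action_map _ _
  have hdep : ∀ a : ArraySub.{u, v} Var, a.Dep vars → (a.toProphSub Dom).Dep vars :=
    fun a h => ⟨h.1, h.2.1, fun s s' t t' hs hs' => by
      simp only [ArraySub.toProphSub, hDom _ _ hs, hDom _ _ hs'], h.2.2⟩
  -- The mapped representation has the same underlying action, so the general case applies to it.
  rw [← hact] at hcond ⊢
  refine hides_specP hp hInit hP hDom (hrep.mono hdep).map fun σ hσ n =>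
    (hcond σ hσ n).imp_left fun h => ?_
  rw [DisjRep.allContexts_map]
  exact rep.allContexts_mono
    (fun a s s' hC ha => ⟨(hC ha).1, isDomInj_idFcn_inter _ _, (hC ha).2⟩) h

open Classical in
-- The only entry is `p` itself: a `renew` step decides it, a `keep` or stuttering step passes it
-- on, with `∅` as a value that is never read.
theorem exists_one_prediction_step {P : Value.{u}} {rep : DisjRep.{u} Var (OneSub.{u, v} Var)}
    (hp : p ∉ vars) (hrep : rep.Dep vars (OneSub.Dep vars)) {s s' : State.{u, v} Var}
    (hstep : rep.action OneSub.act s s' ∨ tup vars s' = tup vars s)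
    (hcond : rep.allContexts (OneSub.cond P) s s' ∨ tup vars s' = tup vars s) :
    ∃ (dec : Prop) (val : Value.{u}), (dec → val ∈ P) ∧
      ∀ x x', x' ∈ P → (dec → x = val) → (¬ dec → x' = x) →
        rep.action (OneSub.actP P p) (Function.update s p x) (Function.update s' p x') ∨
          tupP vars p (Function.update s' p x') = tupP vars p (Function.update s p x) := by
  by_cases hst : tup vars s' = tup vars s
  · refine ⟨False, ∅, False.elim, fun x x' _ _ hkeep => Or.inr ?_⟩
    rw [hkeep id]
    exact tupP_update_eq hp hst x
  obtain ⟨a, hact, hC, hD, hlift⟩ :=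
    DisjRep.exists_sub_of_action hrep (hstep.resolve_right hst) (hcond.resolve_right hst)
  have hs := fun x => (tup_update hp s x).symm
  have hs' := fun x' => (tup_update hp s' x').symm
  cases a with
  | keep A =>
    refine ⟨False, ∅, False.elim, fun x x' _ _ hkeep => Or.inl ?_⟩
    refine hlift _ _ _ (hs x) (hs' x') ⟨?_, trivial, ?_⟩
    · exact (hD.1 _ _ _ _ (hs x) (hs' x')).mp hact
    · simpa only [OneSub.setp, Function.update_self] using hkeep id
  | renew A Pred =>
    obtain ⟨i, hi, hpred⟩ := hC hact
    refine ⟨True, i, fun _ => hi, fun x x' hx' hval _ => Or.inl ?_⟩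
    refine hlift _ _ _ (hs x) (hs' x') ⟨?_, ?_, ?_⟩
    · exact (hD.1 _ _ _ _ (hs x) (hs' x')).mp hact
    · rw [← hD.2 _ _ _ _ (hs x) (hs' x'), Function.update_self, hval trivial]
      exact hpred
    · simpa only [OneSub.setp, Function.update_self] using hx'

/-- Adding a one-prediction prophecy variable. -/
theorem hides_specOne {Init : StatePred.{u, v} Var} {P : Value.{u}}
    {rep : DisjRep.{u} Var (OneSub.{u, v} Var)} (hp : p ∉ vars) (hInit : StateDep vars Init)
    (hP : P.Nonempty) (hrep : rep.Dep vars (OneSub.Dep vars))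
    (hcond : ∀ σ, Spec Init (rep.action OneSub.act) (tup vars) σ →
      BoxAction (rep.allContexts (OneSub.cond P)) (tup vars) σ) :
    Hides p (SpecOne vars p Init P rep) (Spec Init (rep.action OneSub.act) (tup vars)) := by
  classical
  refine hides_of_exists_values hp hInit (hrep.mono fun a h => h.1).stepDep_action
    (fun s h => h.1) (fun s s' => rep.action_mono fun a s s' h => h.1) fun σ hσ => ?_
  choose dec val hval hstep using fun n =>
    exists_one_prediction_step hp hrep (hσ.2 n) (hcond σ hσ n)
  obtain ⟨g, hgP, hgdec, hgnext⟩ := exists_resolution (ι := Unit) (fun n _ => dec n)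
    (fun _ => id) (fun n _ => val n) (S := {y | y ∈ P}) hP fun n _ => hval n
  refine ⟨fun n => g n (), ⟨?_, ?_⟩, fun n => hstep n _ _ (hgP _ _) (hgdec n ()) (hgnext n ())⟩
  · exact (hInit _ _ (tup_update hp (σ 0) _)).mpr hσ.1
  · simpa only [Function.update_self, Set.mem_ofPred_eq] using hgP 0 ()

end Prophecy

end TLA

theorem mainTheorem3 {Var : Type v} (vars : List Var) (p : Var) (hp : p ∉ vars)
    (Init : TLA.StatePred.{u, v} Var) (hInit : TLA.StateDep vars Init)
    (P : TLA.Value.{u}) (hP : P.Nonempty) :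
    -- prophecy data structure variables
    (∀ (Dom : TLA.State.{u, v} Var → TLA.Value.{u})
        (rep : TLA.DisjRep.{u} Var (TLA.ProphSub.{u, v} Var)),
      TLA.StateDep vars Dom →
      rep.Dep vars (TLA.ProphSub.Dep vars) →
      (∀ σ, TLA.Spec Init (rep.action TLA.ProphSub.act) (TLA.tup vars) σ →
        TLA.BoxAction (rep.allContexts (TLA.ProphSub.cond P Dom)) (TLA.tup vars) σ) →
      TLA.Hides p (TLA.SpecP vars p Init P Dom rep)
        (TLA.Spec Init (rep.action TLA.ProphSub.act) (TLA.tup vars))) ∧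
    -- prophecy array variables
    (∀ (Dom : TLA.State.{u, v} Var → TLA.Value.{u})
        (rep : TLA.DisjRep.{u} Var (TLA.ArraySub.{u, v} Var)),
      TLA.StateDep vars Dom →
      rep.Dep vars (TLA.ArraySub.Dep vars) →
      (∀ σ, TLA.Spec Init (rep.action TLA.ArraySub.act) (TLA.tup vars) σ →
        TLA.BoxAction (rep.allContexts (TLA.ArraySub.cond P Dom)) (TLA.tup vars) σ) →
      TLA.Hides p (TLA.SpecP vars p Init P Dom (rep.map (TLA.ArraySub.toProphSub Dom)))
        (TLA.Spec Init (rep.action TLA.ArraySub.act) (TLA.tup vars))) ∧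
    -- one-prediction prophecy variables
    (∀ rep : TLA.DisjRep.{u} Var (TLA.OneSub.{u, v} Var),
      rep.Dep vars (TLA.OneSub.Dep vars) →
      (∀ σ, TLA.Spec Init (rep.action TLA.OneSub.act) (TLA.tup vars) σ →
        TLA.BoxAction (rep.allContexts (TLA.OneSub.cond P)) (TLA.tup vars) σ) →
      TLA.Hides p (TLA.SpecOne vars p Init P rep)
        (TLA.Spec Init (rep.action TLA.OneSub.act) (TLA.tup vars))) :=
  ⟨fun _ _ hDom hrep hcond => TLA.hides_specP hp hInit hP hDom hrep hcond,
    fun _ _ hDom hrep hcond => TLA.hides_specP_array hp hInit hP hDom hrep hcond,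
    fun _ hrep hcond => TLA.hides_specOne hp hInit hP hrep hcond⟩
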